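/- **Conventions.** All locally convex spaces are real and Hausdorff. For $U\subseteq E$ open, a map $f:U\to F$ between locally convex spaces is smooth if it is continuous, all iterated directional derivatives $\mathrm{d}^jf(x)(h_1,\dots,h_j)=(\partial_{h_j}\cdots\partial_{h_1}f)(x)$ exist, and all maps $\mathrm{d}^jf:U\times E^j\to F$ are continuous; smooth manifolds modelled on $E$, smooth maps, tangent spaces $T_m(M)$, tangent maps $T_m(\Phi)$ and smooth vector fields are defined accordingly. A *weak Poisson manifold* $(M,\mathcal A_M,\{\cdot,\cdot\})$ is a smooth manifold $M$ modelled on a locally convex space, with a unital subalgebra $\mathcal A_M\subseteq C^\infty(M,\mathbb R)$ and a Lie bracket $\{\cdot,\cdot\}$ on $\mathcal A_M$ such that $\{F,GH\}=\{F,G\}H+G\{F,H\}$; if $v\in T_m(M)$ and $\mathrm dF(m)v=0$ for all $F\in\mathcal A_M$, then $v=0$; and for each $H\in\mathcal A_M$ there is a (then unique) smooth vector field $X_H$ on $M$ with $X_HF=\{F,H\}$ for all $F\in\mathcal A_M$. A *Poisson map* $\Phi:M\to N$ between weak Poisson manifolds is a smooth map with $F\circ\Phi\in\mathcal A_M$ and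 $\{F,G\}\circ\Phi=\{F\circ\Phi,G\circ\Phi\}$ for all $F,G\in\mathcal A_N$. Let $V$ be a locally convex space and $V_*\subseteq V'$ a linear subspace of the topological dual separating the points of $V$. Let $\Lambda:V_*\times V_*\to\mathbb R$ be a skew-symmetric bilinear form such that for each $\alpha\in V_*$ there is $\alpha^\sharp\in V$ with $\Lambda(\beta,\alpha)=\beta(\alpha^\sharp)$ for all $\beta\in V_*$. Let $[\cdot,\cdot]_0$ be a Lie bracket on $V_*$ for which $\Lambda$ is a 2-cocycle, i.e. $\Lambda([\alpha,\beta]_0,\gamma)+\Lambda([\beta,\gamma]_0,\alpha)+\Lambda([\gamma,\alpha]_0,\beta)=0$, and such that for each $\alpha\in V_*$ there is a continuous linear map $\mathrm{ad}_0^*\alpha:V\to V$ with $\beta((\mathrm{ad}_0^*\alpha)v)=[\alpha,\beta]_0(v)$ for $\beta\in V_*$, $v\in V$. Let $\hat V_*=\mathbb R1+V_*$ be the space of affine functions, with the Lie bracket $[t+\alpha,s+\beta]=\Lambda(\alpha,\beta)+[\alpha,\beta]_0$. The corresponding *affine Poisson space* is $V$ with the unital algebra $\mathcal A_V$ generated by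 $V_*$ and the bracket $\{F,G\}(v)=[\mathrm dF(v),\mathrm dG(v)](v)$ (where $\mathrm dF(v),\mathrm dG(v)\in V_*$); it is a weak Poisson manifold. **Proposition 3.1.** Let $(V,\mathcal A_V)$ be an affine Poisson space as above, $(M,\mathcal A_M)$ a weak Poisson manifold, and $\Phi:M\to V$ a smooth map such that $\phi(\alpha):=\alpha\circ\Phi\in\mathcal A_M$ for every $\alpha\in\hat V_*$. Then the following are equivalent: (i) $\Phi$ is a Poisson map, i.e. $\Phi^*$ maps $\mathcal A_V$ into $\mathcal A_M$ and $\Phi^*\{F,G\}=\{\Phi^*F,\Phi^*G\}$ for all $F,G\in\mathcal A_V$. (ii) $\phi(\{\alpha,\beta\})=\{\phi(\alpha),\phi(\beta)\}$ for all $\alpha,\beta\in V_*$. (iii) $T_m(\Phi)X_{\phi(\alpha)}(m)=X_\alpha(\Phi(m))$ for all $m\in M$ and $\alpha\in V_*$, where $X_{\phi(\alpha)}$ and $X_\alpha$ are the Hamiltonian vector fields on $M$ and $V$. -/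

import Mathlib

open Filter Topology

noncomputable section

set_option linter.unusedSectionVars false

namespace LC

/-! ## Differential calculus on locally convex spaces -/

section Calculus

variable {E F : Type*}
  [AddCommGroup E] [Module ℝ E] [TopologicalSpace E]
  [AddCommGroup F] [Module ℝ F] [TopologicalSpace F]

/-- `y` is the derivative of `f` at `x` in the direction `h`:
`y = lim_{t → 0} t⁻¹ (f (x + t h) - f x)`. -/
def HasDirDeriv (f : E → F) (x h : E) (y : F) : Prop :=
  Tendsto (fun t : ℝ => t⁻¹ • (f (x + t • h) - f x)) (𝓝[≠] 0) (𝓝 y)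

/-- The directional derivative `df(x)(h)` (a junk value if the limit does not exist). -/
def dirDeriv (f : E → F) (x h : E) : F :=
  limUnder (𝓝[≠] (0 : ℝ)) (fun t : ℝ => t⁻¹ • (f (x + t • h) - f x))

/-- The iterated directional derivative
`dʲf(x)(h₁, …, hⱼ) = (∂_{hⱼ} ⋯ ∂_{h₁} f)(x)`. -/
def iterDirDeriv (f : E → F) : (j : ℕ) → E → (Fin j → E) → F
  | 0, x, _ => f x
  | j + 1, x, h => dirDeriv (fun y => iterDirDeriv f j y (Fin.init h)) x (h (Fin.last j))

/-- `f` is a `C^∞`-map on the (open) set `U`: all iterated directional derivatives exist on `U`,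
and all maps `dʲf : U × Eʲ → F` (including `d⁰f = f`) are continuous. -/
def SmoothOn (f : E → F) (U : Set E) : Prop :=
  (∀ (j : ℕ), ∀ x ∈ U, ∀ (h : Fin j → E) (v : E),
    ∃ y, HasDirDeriv (fun z => iterDirDeriv f j z h) x v y) ∧
  ∀ j : ℕ, ContinuousOn (fun p : E × (Fin j → E) => iterDirDeriv f j p.1 p.2) (U ×ˢ Set.univ)

theorem HasDirDeriv.eq [T2Space F] {f : E → F} {x h : E} {y : F} (H : HasDirDeriv f x h y) :
    dirDeriv f x h = y := Tendsto.limUnder_eq H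

theorem HasDirDeriv.unique [T2Space F] {f : E → F} {x h : E} {y z : F} (H : HasDirDeriv f x h y)
    (H' : HasDirDeriv f x h z) : y = z := tendsto_nhds_unique H H'

theorem hasDirDeriv_const [T2Space F] (c : F) (x h : E) : HasDirDeriv (fun _ => c) x h 0 := by
  simp [HasDirDeriv]

theorem hasDirDeriv_clm (T : E →L[ℝ] F) (x h : E) : HasDirDeriv T x h (T h) := by
  refine Tendsto.congr' ?_ tendsto_const_nhds
  filter_upwards [self_mem_nhdsWithin] with t ht
  simp only [map_add, map_smul, add_sub_cancel_left, smul_smul]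
  rw [inv_mul_cancel₀ ht, one_smul]

theorem HasDirDeriv.add [IsTopologicalAddGroup F] {f g : E → F} {x h : E} {y z : F}
    (hf : HasDirDeriv f x h y) (hg : HasDirDeriv g x h z) :
    HasDirDeriv (fun x => f x + g x) x h (y + z) := by
  refine (Tendsto.add hf hg).congr fun t => ?_
  rw [← smul_add, add_sub_add_comm]

theorem tendsto_line [IsTopologicalAddGroup E] [ContinuousSMul ℝ E] (x h : E) :
    Tendsto (fun t : ℝ => x + t • h) (𝓝[≠] 0) (𝓝 x) := by
  have : Continuous (fun t : ℝ => x + t • h) := by fun_prop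
  simpa using (this.tendsto 0).mono_left nhdsWithin_le_nhds

theorem HasDirDeriv.smul [IsTopologicalAddGroup E] [ContinuousSMul ℝ E]
    [IsTopologicalAddGroup F] [ContinuousSMul ℝ F] {p : E → ℝ} {g : E → F} {x h : E}
    {p' : ℝ} {g' : F} (hp : HasDirDeriv p x h p') (hg : HasDirDeriv g x h g')
    (hc : Continuous g) :
    HasDirDeriv (fun x => p x • g x) x h (p x • g' + p' • g x) := by
  have hgt : Tendsto (fun t : ℝ => g (x + t • h)) (𝓝[≠] 0) (𝓝 (g x)) :=
    (hc.tendsto x).comp (tendsto_line x h)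
  refine ((Tendsto.const_smul hg (p x)).add (Tendsto.smul hp hgt)).congr fun t => ?_
  simp only [smul_sub, sub_smul, smul_smul, smul_eq_mul, mul_comm (p x), mul_sub]
  abel

theorem SmoothOn.hasDirDeriv [T2Space F] {f : E → F} {U : Set E} (hf : SmoothOn f U) {x : E}
    (hx : x ∈ U) (h : E) : HasDirDeriv f x h (dirDeriv f x h) := by
  obtain ⟨y, hy⟩ := hf.1 0 x hx Fin.elim0 h
  have hy' : HasDirDeriv f x h y := hy
  rwa [hy'.eq]

theorem SmoothOn.tendsto_aux [IsTopologicalAddGroup E] [ContinuousSMul ℝ E]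
    {f : E → ℝ} {U : Set E} (hU : IsOpen U) (hf : SmoothOn f U) {x : E}
    (hx : x ∈ U) (h k : E) :
    Tendsto (fun t : ℝ => t⁻¹ • (f (x + t • (h + k)) - f (x + t • h))) (𝓝[≠] 0)
      (𝓝 (dirDeriv f x k)) := by
  have hcont : ContinuousAt (fun y => dirDeriv f y k) x := by
    have h1 := hf.2 1
    have h2 : ContinuousOn (fun y : E => iterDirDeriv f 1 y (fun _ => k)) U :=
      h1.comp (f := fun y : E => (y, fun _ : Fin 1 => k)) (by fun_prop)
        (fun y hy => ⟨hy, trivial⟩)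
    exact (h2.continuousAt (hU.mem_nhds hx))
  rw [Metric.tendsto_nhds]
  intro ε hε
  have hW : {y | y ∈ U ∧ dist (dirDeriv f y k) (dirDeriv f x k) < ε} ∈ 𝓝 x :=
    inter_mem (hU.mem_nhds hx) (Metric.tendsto_nhds.1 hcont ε hε)
  have hψ : Tendsto (fun p : ℝ × ℝ => x + p.1 • h + p.2 • k) (𝓝 (0, 0)) (𝓝 x) := by
    have : Continuous (fun p : ℝ × ℝ => x + p.1 • h + p.2 • k) := by fun_prop
    simpa using this.tendsto (0, 0)
  obtain ⟨δ, hδ, hball⟩ := Metric.mem_nhds_iff.1 (hψ hW)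
  have hsmall : ∀ᶠ t : ℝ in 𝓝[≠] 0, |t| < δ := by
    filter_upwards [mem_nhdsWithin_of_mem_nhds (Metric.ball_mem_nhds (0 : ℝ) hδ)] with t ht
    simpa using ht
  filter_upwards [hsmall, self_mem_nhdsWithin] with t ht ht0
  have hin : ∀ s ∈ Set.Icc (0 : ℝ) 1, x + t • h + (s * t) • k ∈
      {y | y ∈ U ∧ dist (dirDeriv f y k) (dirDeriv f x k) < ε} := by
    intro s hs
    refine hball (show ((t, s * t) : ℝ × ℝ) ∈ Metric.ball (0, 0) δ from ?_)
    simp only [Metric.mem_ball, Prod.dist_eq, Real.dist_eq, sub_zero, max_lt_iff, abs_mul]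
    refine ⟨ht, lt_of_le_of_lt ?_ ht⟩
    exact mul_le_of_le_one_left (abs_nonneg t) (abs_le.2 ⟨by linarith [hs.1], hs.2⟩)
  have hder : ∀ s ∈ Set.Icc (0 : ℝ) 1, HasDerivAt (fun s : ℝ => f (x + t • h + (s * t) • k))
      (t * dirDeriv f (x + t • h + (s * t) • k) k) s := by
    intro s hs
    have h1 := hf.hasDirDeriv (hin s hs).1 k
    have h2 : HasDerivAt (fun r : ℝ => f (x + t • h + (s * t) • k + r • k))
        (dirDeriv f (x + t • h + (s * t) • k) k) 0 := by
      rw [hasDerivAt_iff_tendsto_slope_zero]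
      simpa [HasDirDeriv] using h1
    have h3 : HasDerivAt (fun s' : ℝ => (s' - s) * t) t s := by
      simpa using ((hasDerivAt_id s).sub_const s).mul_const t
    have h4 := HasDerivAt.comp s (h₂ := fun r : ℝ => f (x + t • h + (s * t) • k + r • k))
      (h := fun s' : ℝ => (s' - s) * t) (by simpa using h2) h3
    rw [mul_comm]
    refine h4.congr_of_eventuallyEq (Eventually.of_forall fun s' => ?_)
    simp only [Function.comp]
    congr 1
    rw [add_assoc (x + t • h), ← add_smul]
    congr 2; ring
  obtain ⟨s, hs, hseq⟩ := exists_hasDerivAt_eq_slope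
    (fun s : ℝ => f (x + t • h + (s * t) • k)) _ (zero_lt_one)
    (fun s hs => (hder s hs).continuousAt.continuousWithinAt)
    (fun s hs => hder s (Set.Ioo_subset_Icc_self hs))
  have hval : t⁻¹ • (f (x + t • (h + k)) - f (x + t • h)) =
      dirDeriv f (x + t • h + (s * t) • k) k := by
    simp only [one_mul, zero_mul, zero_smul, add_zero, sub_zero, div_one] at hseq
    rw [smul_add, ← add_assoc, ← hseq, smul_eq_mul, inv_mul_cancel_left₀ ht0]
  rw [hval]
  exact (hin s (Set.Ioo_subset_Icc_self hs)).2

/-- Additivity of the derivative of a smooth real-valued function. -/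
theorem SmoothOn.dirDeriv_add [IsTopologicalAddGroup E] [ContinuousSMul ℝ E]
    {f : E → ℝ} {U : Set E} (hU : IsOpen U) (hf : SmoothOn f U) {x : E}
    (hx : x ∈ U) (h k : E) : dirDeriv f x (h + k) = dirDeriv f x h + dirDeriv f x k := by
  refine HasDirDeriv.eq ?_
  refine (Tendsto.add (hf.hasDirDeriv hx h) (hf.tendsto_aux hU hx h k)).congr fun t => ?_
  rw [← smul_add, add_comm (f _ - _), sub_add_sub_cancel]

/-- A criterion for smoothness: `f` belongs to a class of continuous functions of
`(x, h₁, …, hⱼ)` that is stable under differentiation with respect to `x`. -/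
theorem smoothOn_of_class [T2Space F] (C : ∀ j : ℕ, Set (E × (Fin j → E) → F))
    (hcont : ∀ j, ∀ g ∈ C j, Continuous g)
    (hder : ∀ j, ∀ g ∈ C j, ∃ g' ∈ C (j + 1), ∀ x (h : Fin (j + 1) → E),
      HasDirDeriv (fun y => g (y, Fin.init h)) x (h (Fin.last j)) (g' (x, h)))
    {f : E → F} {g : E × (Fin 0 → E) → F} (hg : g ∈ C 0) (hfg : ∀ x h, f x = g (x, h))
    (U : Set E) : SmoothOn f U := by
  have main : ∀ j, ∃ g ∈ C j, ∀ x h, iterDirDeriv f j x h = g (x, h) := by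
    intro j
    induction j with
    | zero => exact ⟨g, hg, hfg⟩
    | succ j ih =>
      obtain ⟨g, hg, e⟩ := ih
      obtain ⟨g', hg', d⟩ := hder j g hg
      refine ⟨g', hg', fun x h => ?_⟩
      simp only [iterDirDeriv, e]
      exact (d x h).eq
  refine ⟨fun j x _ h v => ?_, fun j => ?_⟩
  · obtain ⟨g, hg, e⟩ := main j
    obtain ⟨g', -, d⟩ := hder j g hg
    refine ⟨g' (x, Fin.snoc h v), ?_⟩
    have := d x (Fin.snoc h v : Fin (j + 1) → E)
    simp only [Fin.init_snoc, Fin.snoc_last] at this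
    simpa only [e] using this
  · obtain ⟨g, hg, e⟩ := main j
    simp only [e]
    exact (hcont j g hg).continuousOn

end Calculus

/-! ## Manifolds modelled on locally convex spaces -/

section Manifolds

/-- A smooth manifold modelled on the locally convex space `E`: all changes of charts of the given
atlas are smooth. -/
class IsLCManifold (E : Type*) [AddCommGroup E] [Module ℝ E] [TopologicalSpace E]
    (M : Type*) [TopologicalSpace M] [ChartedSpace E M] : Prop where
  compatible : ∀ e ∈ atlas E M, ∀ e' ∈ atlas E M,
    SmoothOn (e' ∘ e.symm) (e.symm.trans e').source

/-- The tangent space `T_m(M)`; a tangent vector at `m` is described by its coordinates with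
respect to the preferred chart `chartAt E m` at `m`. -/
abbrev Tangent (E : Type*) {M : Type*} (_m : M) : Type _ := E

variable (E : Type*) [AddCommGroup E] [Module ℝ E] [TopologicalSpace E]
  {M : Type*} [TopologicalSpace M] [ChartedSpace E M]
  (F : Type*) [AddCommGroup F] [Module ℝ F] [TopologicalSpace F]
  {N : Type*} [TopologicalSpace N] [ChartedSpace F N]

/-- Smooth maps between manifolds: continuous maps that are smooth in charts. -/
def SmoothMap (f : M → N) : Prop :=
  Continuous f ∧ ∀ e ∈ atlas E M, ∀ e' ∈ atlas F N,
    SmoothOn (e' ∘ f ∘ e.symm) (e.target ∩ e.symm ⁻¹' (f ⁻¹' e'.source))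

/-- The tangent map `T_m(f) : T_m(M) → T_{f(m)}(N)`. For `N = ℝ` (with its identity chart) this is
the differential `df(m)`. -/
def tangentMap (f : M → N) (m : M) (v : Tangent E m) : Tangent F (f m) :=
  dirDeriv (chartAt F (f m) ∘ f ∘ (chartAt E m).symm) (chartAt E m m) v

/-- The vector field `X` is smooth: for each chart `e` of the atlas, its local representative
`e.target → E`, `y ↦ T(e)(X(e⁻¹ y))`, is smooth. -/
def SmoothVectorField (X : ∀ m : M, Tangent E m) : Prop :=
  ∀ e ∈ atlas E M, SmoothOn
    (fun y => dirDeriv (e ∘ (chartAt E (e.symm y)).symm) (chartAt E (e.symm y) (e.symm y))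
      (X (e.symm y))) e.target

end Manifolds

/-! ## Weak Poisson manifolds -/

section Poisson

/-- A weak Poisson structure on the manifold `M` modelled on `E`. -/
structure WeakPoissonStructure (E : Type*) [AddCommGroup E] [Module ℝ E] [TopologicalSpace E]
    (M : Type*) [TopologicalSpace M] [ChartedSpace E M] where
  /-- the unital subalgebra `𝒜` of `C^∞(M, ℝ)` -/
  alg : Subalgebra ℝ (M → ℝ)
  smooth : ∀ F ∈ alg, SmoothMap E ℝ F
  /-- the Poisson bracket `{·,·}` -/
  bracket : alg →ₗ[ℝ] alg →ₗ[ℝ] alg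
  skew : ∀ F G, bracket F G = -bracket G F
  jacobi : ∀ F G H,
    bracket F (bracket G H) = bracket (bracket F G) H + bracket G (bracket F H)
  leibniz : ∀ F G H, bracket F (G * H) = bracket F G * H + G * bracket F H
  separating : ∀ (m : M) (v : Tangent E m),
    (∀ F : alg, tangentMap E ℝ (F : M → ℝ) m v = 0) → v = 0
  exists_hamiltonian : ∀ H : alg, ∃ X : ∀ m : M, Tangent E m, SmoothVectorField E X ∧
    ∀ (F : alg) (m : M), tangentMap E ℝ (F : M → ℝ) m (X m) = (bracket F H : M → ℝ) m

variable {E : Type*} [AddCommGroup E] [Module ℝ E] [TopologicalSpace E]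
  {M : Type*} [TopologicalSpace M] [ChartedSpace E M]
  {F : Type*} [AddCommGroup F] [Module ℝ F] [TopologicalSpace F]
  {N : Type*} [TopologicalSpace N] [ChartedSpace F N]

/-- The Hamiltonian vector field `X_H` of `H ∈ 𝒜`. -/
def WeakPoissonStructure.hamiltonian (P : WeakPoissonStructure E M) (H : P.alg) :
    ∀ m : M, Tangent E m := (P.exists_hamiltonian H).choose

/-- `X_H` is the only vector field with `X_H F = {F, H}` for all `F ∈ 𝒜`. -/
theorem WeakPoissonStructure.hamiltonian_unique [IsTopologicalAddGroup E] [ContinuousSMul ℝ E]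
    (P : WeakPoissonStructure E M) (H : P.alg)
    (X : ∀ m : M, Tangent E m)
    (hX : ∀ (F : P.alg) (m : M), tangentMap E ℝ (F : M → ℝ) m (X m) = (P.bracket F H : M → ℝ) m) :
    X = P.hamiltonian H := by
  funext m
  refine sub_eq_zero.1 (P.separating m _ fun F => ?_)
  have h1 := (hX F m).trans ((P.exists_hamiltonian H).choose_spec.2 F m).symm
  have hs := (P.smooth F F.2).2 _ (chart_mem_atlas E m) _ (chart_mem_atlas ℝ ((F : M → ℝ) m))
  have h2 := hs.dirDeriv_add (x := chartAt E m m)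
    (by simpa [chartAt_self_eq] using (chartAt E m).open_target) (by simp [chartAt_self_eq])
    (X m - P.hamiltonian H m) (P.hamiltonian H m)
  rw [sub_add_cancel] at h2
  simp only [tangentMap, WeakPoissonStructure.hamiltonian] at h1 h2 ⊢
  linarith

/-- `Φ : M → N` is a Poisson map: it is smooth, `Φ^*` maps `𝒜_N` to `𝒜_M`, and it preserves the
Poisson brackets. -/
def IsPoissonMap (P : WeakPoissonStructure E M) (Q : WeakPoissonStructure F N) (Φ : M → N) :
    Prop :=
  SmoothMap E F Φ ∧ ∃ h : ∀ f : Q.alg, (f : N → ℝ) ∘ Φ ∈ P.alg,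
    ∀ f g : Q.alg, (Q.bracket f g : N → ℝ) ∘ Φ = P.bracket ⟨_, h f⟩ ⟨_, h g⟩

end Poisson

/-! ## Affine Poisson structures -/

section Affine

/-- The data defining an affine Poisson structure on the locally convex space `V`: a separating
space `V_*` of continuous linear functionals, a skew-symmetric bilinear form `Λ` on `V_*`
such that each `Λ(·, α)` is given by evaluation in some `α^♯ ∈ V`, and a Lie bracket `[·,·]₀` on
`V_*` for which `Λ` is a 2-cocycle and each `ad₀ α` has a continuous adjoint on `V`. -/
structure AffinePoissonData (V : Type*) [AddCommGroup V] [Module ℝ V] [TopologicalSpace V]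
    [IsTopologicalAddGroup V] [ContinuousSMul ℝ V] where
  /-- the space `V_*` -/
  dual : Submodule ℝ (V →L[ℝ] ℝ)
  separating : ∀ v : V, (∀ α ∈ dual, α v = 0) → v = 0
  /-- the form `Λ` -/
  form : dual →ₗ[ℝ] dual →ₗ[ℝ] ℝ
  form_skew : ∀ α β, form α β = -form β α
  exists_sharp : ∀ α : dual, ∃ v : V, ∀ β : dual, form β α = (β : V →L[ℝ] ℝ) v
  /-- the Lie bracket `[·,·]₀` -/
  bracket₀ : dual →ₗ[ℝ] dual →ₗ[ℝ] dual
  bracket₀_skew : ∀ α β, bracket₀ α β = -bracket₀ β α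
  bracket₀_jacobi : ∀ α β γ,
    bracket₀ α (bracket₀ β γ) = bracket₀ (bracket₀ α β) γ + bracket₀ β (bracket₀ α γ)
  cocycle : ∀ α β γ,
    form (bracket₀ α β) γ + form (bracket₀ β γ) α + form (bracket₀ γ α) β = 0
  exists_adjoint : ∀ α : dual, ∃ T : V →L[ℝ] V, ∀ (β : dual) (v : V),
    (β : V →L[ℝ] ℝ) (T v) = (bracket₀ α β : V →L[ℝ] ℝ) v

variable {V : Type*} [AddCommGroup V] [Module ℝ V] [TopologicalSpace V]
  [IsTopologicalAddGroup V] [ContinuousSMul ℝ V]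

/-- The space `V̂_* = ℝ 1 + V_*` of affine functions on `V`. -/
def AffinePoissonData.affineFunctions (D : AffinePoissonData V) : Submodule ℝ (V → ℝ) where
  carrier := {f | ∃ (t : ℝ) (α : D.dual), f = fun v => t + (α : V →L[ℝ] ℝ) v}
  add_mem' := by
    rintro _ _ ⟨t, α, rfl⟩ ⟨s, β, rfl⟩
    exact ⟨t + s, α + β, by funext v; simp; ring⟩
  zero_mem' := ⟨0, 0, by funext v; simp⟩
  smul_mem' := by
    rintro c _ ⟨t, α, rfl⟩
    exact ⟨c * t, c • α, by funext v; simp; ring⟩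

/-- The bracket `[α, β] = Λ(α, β) + [α, β]₀` of `α, β ∈ V_*`, an affine function on `V`. -/
def AffinePoissonData.affineBracket (D : AffinePoissonData V) (α β : D.dual) (v : V) : ℝ :=
  D.form α β + (D.bracket₀ α β : V →L[ℝ] ℝ) v

/-- The unital algebra `𝒜` of functions on `V` generated by `V_*`. -/
def AffinePoissonData.alg (D : AffinePoissonData V) : Subalgebra ℝ (V → ℝ) :=
  Algebra.adjoin ℝ (Set.range fun α : D.dual => ((α : V →L[ℝ] ℝ) : V → ℝ))

/-- An element of `V_*` as an element of `𝒜`. -/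
def AffinePoissonData.toAlg (D : AffinePoissonData V) (α : D.dual) : D.alg :=
  ⟨((α : V →L[ℝ] ℝ) : V → ℝ), Algebra.subset_adjoin ⟨α, rfl⟩⟩

namespace AffinePoissonData

variable (D : AffinePoissonData V)

theorem alg_induction {p : D.alg → Prop} (hc : ∀ r : ℝ, p (algebraMap ℝ D.alg r))
    (hα : ∀ α : D.dual, p (D.toAlg α)) (hadd : ∀ F G, p F → p G → p (F + G))
    (hmul : ∀ F G, p F → p G → p (F * G)) (F : D.alg) : p F := by
  obtain ⟨F, hF⟩ := F
  refine Algebra.adjoin_induction (p := fun F hF => p ⟨F, hF⟩) ?_ hc ?_ ?_ hF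
  · rintro _ ⟨α, rfl⟩; exact hα α
  · exact fun F G hF hG h1 h2 => hadd ⟨F, hF⟩ ⟨G, hG⟩ h1 h2
  · exact fun F G hF hG h1 h2 => hmul ⟨F, hF⟩ ⟨G, hG⟩ h1 h2

theorem continuous_alg (F : D.alg) : Continuous (F : V → ℝ) := by
  refine D.alg_induction (p := fun F => Continuous (F : V → ℝ)) ?_ ?_ ?_ ?_ F
  · exact fun r => continuous_const
  · exact fun α => (α : V →L[ℝ] ℝ).continuous
  · exact fun F G hF hG => hF.add hG
  · exact fun F G hF hG => hF.mul hG

theorem exists_diff (F : D.alg) (v : V) :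
    ∃ α : D.dual, ∀ h, HasDirDeriv (F : V → ℝ) v h ((α : V →L[ℝ] ℝ) h) := by
  refine D.alg_induction (p := fun F => ∃ α : D.dual, ∀ h, HasDirDeriv (F : V → ℝ) v h
    ((α : V →L[ℝ] ℝ) h)) ?_ ?_ ?_ ?_ F
  · exact fun r => ⟨0, fun h => hasDirDeriv_const r v h⟩
  · exact fun α => ⟨α, fun h => hasDirDeriv_clm _ v h⟩
  · rintro F G ⟨α, hα⟩ ⟨β, hβ⟩
    exact ⟨α + β, fun h => (hα h).add (hβ h)⟩
  · rintro F G ⟨α, hα⟩ ⟨β, hβ⟩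
    refine ⟨(F : V → ℝ) v • β + (G : V → ℝ) v • α, fun h => ?_⟩
    have := (hα h).smul (hβ h) (D.continuous_alg G)
    refine Eq.mp ?_ this
    congr 1
    simp [mul_comm]

/-- The differential `dF(v)` of `F ∈ 𝒜`, as an element of `V_*`. -/
def diff (F : D.alg) (v : V) : D.dual := (D.exists_diff F v).choose

theorem hasDirDeriv_diff (F : D.alg) (v h : V) :
    HasDirDeriv (F : V → ℝ) v h ((D.diff F v : V →L[ℝ] ℝ) h) := (D.exists_diff F v).choose_spec h

theorem diff_eq {F : D.alg} {v : V} {α : D.dual}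
    (H : ∀ h, HasDirDeriv (F : V → ℝ) v h ((α : V →L[ℝ] ℝ) h)) : D.diff F v = α :=
  Subtype.ext (ContinuousLinearMap.ext fun h => (D.hasDirDeriv_diff F v h).unique (H h))

theorem diff_const (r : ℝ) (v : V) : D.diff (algebraMap ℝ D.alg r) v = 0 :=
  D.diff_eq fun h => hasDirDeriv_const r v h

theorem diff_toAlg (α : D.dual) (v : V) : D.diff (D.toAlg α) v = α :=
  D.diff_eq fun h => hasDirDeriv_clm _ v h

theorem diff_add (F G : D.alg) (v : V) : D.diff (F + G) v = D.diff F v + D.diff G v :=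
  D.diff_eq fun h => (D.hasDirDeriv_diff F v h).add (D.hasDirDeriv_diff G v h)

theorem diff_mul (F G : D.alg) (v : V) :
    D.diff (F * G) v = (F : V → ℝ) v • D.diff G v + (G : V → ℝ) v • D.diff F v :=
  D.diff_eq fun h => by
    have := (D.hasDirDeriv_diff F v h).smul (D.hasDirDeriv_diff G v h) (D.continuous_alg G)
    refine Eq.mp ?_ this
    congr 1
    simp [mul_comm]

theorem diff_smul (c : ℝ) (F : D.alg) (v : V) : D.diff (c • F) v = c • D.diff F v := by
  rw [Algebra.smul_def, diff_mul, diff_const, smul_zero, add_zero]; rfl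

/-- The Poisson bracket as a function: `{F, G}(v) = ⟨[dF(v), dG(v)], v⟩`. -/
def poissonFun (F G : D.alg) (v : V) : ℝ := D.affineBracket (D.diff F v) (D.diff G v) v

theorem affineBracket_mem (α β : D.dual) : D.affineBracket α β ∈ D.alg :=
  (algebraMap ℝ D.alg (D.form α β) + D.toAlg (D.bracket₀ α β)).2

theorem poissonFun_skew (F G : D.alg) (v : V) : D.poissonFun F G v = -D.poissonFun G F v := by
  simp only [poissonFun, affineBracket]
  rw [D.form_skew, D.bracket₀_skew]; simp; ring

theorem poissonFun_add (F G H : D.alg) (v : V) :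
    D.poissonFun F (G + H) v = D.poissonFun F G v + D.poissonFun F H v := by
  simp [poissonFun, affineBracket, diff_add]; ring

theorem poissonFun_smul (c : ℝ) (F G : D.alg) (v : V) :
    D.poissonFun F (c • G) v = c * D.poissonFun F G v := by
  simp [poissonFun, affineBracket, diff_smul]; ring

theorem poissonFun_const (F : D.alg) (r : ℝ) (v : V) :
    D.poissonFun F (algebraMap ℝ D.alg r) v = 0 := by
  simp [poissonFun, affineBracket, diff_const]

theorem poissonFun_mul (F G H : D.alg) (v : V) : D.poissonFun F (G * H) v =
    D.poissonFun F G v * (H : V → ℝ) v + (G : V → ℝ) v * D.poissonFun F H v := by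
  simp [poissonFun, affineBracket, diff_mul]; ring

theorem poissonFun_mem (F G : D.alg) : D.poissonFun F G ∈ D.alg := by
  refine D.alg_induction (p := fun G => D.poissonFun F G ∈ D.alg) ?_ ?_ ?_ ?_ G
  · intro r
    convert D.alg.zero_mem using 1
    funext v; exact D.poissonFun_const F r v
  · intro β
    refine D.alg_induction (p := fun F => D.poissonFun F (D.toAlg β) ∈ D.alg) ?_ ?_ ?_ ?_ F
    · intro r
      convert D.alg.zero_mem using 1
      funext v; rw [poissonFun_skew, poissonFun_const]; simp
    · intro α
      convert D.affineBracket_mem α β using 1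
      funext v; simp [poissonFun, diff_toAlg]
    · intro F G hF hG
      convert D.alg.add_mem hF hG using 1
      funext v
      rw [Pi.add_apply, poissonFun_skew, poissonFun_add, D.poissonFun_skew F,
        D.poissonFun_skew G]; ring
    · intro F G hF hG
      convert D.alg.add_mem (D.alg.mul_mem hF G.2) (D.alg.mul_mem F.2 hG) using 1
      funext v
      rw [Pi.add_apply, Pi.mul_apply, Pi.mul_apply, poissonFun_skew, poissonFun_mul,
        D.poissonFun_skew F, D.poissonFun_skew G]; ring
  · intro G H hG hH
    convert D.alg.add_mem hG hH using 1
    funext v; exact D.poissonFun_add F G H v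
  · intro G H hG hH
    convert D.alg.add_mem (D.alg.mul_mem hG H.2) (D.alg.mul_mem G.2 hH) using 1
    funext v; exact D.poissonFun_mul F G H v

/-- The Poisson bracket `𝒜 × 𝒜 → 𝒜`. -/
def poisson : D.alg →ₗ[ℝ] D.alg →ₗ[ℝ] D.alg :=
  LinearMap.mk₂ ℝ (fun F G => ⟨D.poissonFun F G, D.poissonFun_mem F G⟩)
    (fun F G H => Subtype.ext (funext fun v => by
      change D.poissonFun _ _ v = D.poissonFun _ _ v + D.poissonFun _ _ v
      rw [poissonFun_skew, poissonFun_add, D.poissonFun_skew F, D.poissonFun_skew G]; ring))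
    (fun c F G => Subtype.ext (funext fun v => by
      change D.poissonFun _ _ v = c * D.poissonFun _ _ v
      rw [poissonFun_skew, poissonFun_smul, D.poissonFun_skew F]; ring))
    (fun F G H => Subtype.ext (funext fun v => D.poissonFun_add F G H v))
    (fun c F G => Subtype.ext (funext fun v => D.poissonFun_smul c F G v))

theorem poisson_skew (F G : D.alg) : D.poisson F G = -D.poisson G F :=
  Subtype.ext (funext fun v => D.poissonFun_skew F G v)

theorem poisson_mul (F G H : D.alg) :
    D.poisson F (G * H) = D.poisson F G * H + G * D.poisson F H :=
  Subtype.ext (funext fun v => D.poissonFun_mul F G H v)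

theorem poisson_const (F : D.alg) (r : ℝ) : D.poisson F (algebraMap ℝ D.alg r) = 0 :=
  Subtype.ext (funext fun v => D.poissonFun_const F r v)

theorem poisson_toAlg (α β : D.dual) : D.poisson (D.toAlg α) (D.toAlg β) =
    algebraMap ℝ D.alg (D.form α β) + D.toAlg (D.bracket₀ α β) :=
  Subtype.ext (funext fun v => by
    change D.poissonFun _ _ v = D.form α β + _
    simp only [poissonFun, diff_toAlg]; rfl)

/-- The vanishing of the Jacobiator. -/
def Cyc (F G H : D.alg) : Prop :=
  D.poisson F (D.poisson G H) + D.poisson G (D.poisson H F) + D.poisson H (D.poisson F G) = 0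

theorem Cyc.rotate {D : AffinePoissonData V} {F G H : D.alg} (h : D.Cyc F G H) :
    D.Cyc G H F := by
  unfold Cyc at *; rw [← h]; abel

theorem cyc_third (F G : D.alg) (h : ∀ γ, D.Cyc F G (D.toAlg γ)) (H : D.alg) : D.Cyc F G H := by
  refine D.alg_induction (p := fun H => D.Cyc F G H) ?_ h ?_ ?_ H
  · intro r
    unfold Cyc
    rw [D.poisson_skew _ F, D.poisson_skew _ (D.poisson F G)]; simp [poisson_const]
  · intro H K hH hK
    unfold Cyc at *
    simp only [map_add, LinearMap.add_apply]
    linear_combination hH + hK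
  · intro H K hH hK
    unfold Cyc at *
    rw [D.poisson_skew _ F, D.poisson_skew _ (D.poisson F G)] at hH hK ⊢
    simp only [poisson_mul, map_add, map_neg] at *
    linear_combination K * hH + H * hK

theorem cyc_all (F G H : D.alg) : D.Cyc F G H := by
  have h0 : ∀ α β γ, D.Cyc (D.toAlg α) (D.toAlg β) (D.toAlg γ) := by
    intro α β γ
    unfold Cyc
    simp only [poisson_toAlg, map_add, poisson_const, zero_add]
    refine Subtype.ext (funext fun v => ?_)
    change D.form α (D.bracket₀ β γ) + (D.bracket₀ α (D.bracket₀ β γ) : V →L[ℝ] ℝ) v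
      + (D.form β (D.bracket₀ γ α) + (D.bracket₀ β (D.bracket₀ γ α) : V →L[ℝ] ℝ) v)
      + (D.form γ (D.bracket₀ α β) + (D.bracket₀ γ (D.bracket₀ α β) : V →L[ℝ] ℝ) v) = 0
    have hc := D.cocycle α β γ
    have hj := congrArg (fun x : D.dual => (x : V →L[ℝ] ℝ) v) (D.bracket₀_jacobi α β γ)
    have e1 : D.bracket₀ γ (D.bracket₀ α β) = -D.bracket₀ (D.bracket₀ α β) γ :=
      D.bracket₀_skew _ _
    have e2 : D.bracket₀ β (D.bracket₀ γ α) = -D.bracket₀ β (D.bracket₀ α γ) := by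
      have hn : ∀ x : D.dual, -x = (-1 : ℝ) • x := fun x =>
        Subtype.ext (neg_one_smul ℝ (x : V →L[ℝ] ℝ)).symm
      rw [D.bracket₀_skew γ α, hn, hn, map_smul]
    rw [D.form_skew α, D.form_skew β, D.form_skew γ, e1, e2]
    change (D.bracket₀ α (D.bracket₀ β γ) : V →L[ℝ] ℝ) v =
      (D.bracket₀ (D.bracket₀ α β) γ : V →L[ℝ] ℝ) v +
      (D.bracket₀ β (D.bracket₀ α γ) : V →L[ℝ] ℝ) v at hj
    change _ + (_ + -(D.bracket₀ β (D.bracket₀ α γ) : V →L[ℝ] ℝ) v) +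
      (_ + -(D.bracket₀ (D.bracket₀ α β) γ : V →L[ℝ] ℝ) v) = 0
    linarith
  have h1 : ∀ α β H, D.Cyc (D.toAlg α) (D.toAlg β) H := fun α β =>
    D.cyc_third _ _ (h0 α β)
  have h2 : ∀ α G H, D.Cyc (D.toAlg α) G H := fun α G H =>
    (D.cyc_third H (D.toAlg α) (fun γ => (h1 α γ H).rotate.rotate) G).rotate
  exact (D.cyc_third G H (fun γ => (h2 γ G H).rotate) F).rotate.rotate

theorem poisson_jacobi (F G H : D.alg) : D.poisson F (D.poisson G H) =
    D.poisson (D.poisson F G) H + D.poisson G (D.poisson F H) := by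
  have h := D.cyc_all F G H
  unfold Cyc at h
  rw [D.poisson_skew H F, D.poisson_skew H (D.poisson F G), map_neg] at h
  linear_combination h

/-- Polynomial functions of `(x, h₁, …, hⱼ)`. -/
def polyAlg (V : Type*) [AddCommGroup V] [Module ℝ V] [TopologicalSpace V] (j : ℕ) :
    Subalgebra ℝ (V × (Fin j → V) → ℝ) :=
  Algebra.adjoin ℝ {g | (∃ α : V →L[ℝ] ℝ, g = fun p => α p.1) ∨
    ∃ (α : V →L[ℝ] ℝ) (i : Fin j), g = fun p => α (p.2 i)}

theorem polyAlg_init (j : ℕ) : ∀ g ∈ polyAlg V j,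
    (fun p : V × (Fin (j + 1) → V) => g (p.1, Fin.init p.2)) ∈ polyAlg V (j + 1) := by
  intro g hg
  refine Algebra.adjoin_induction (p := fun g _ =>
    (fun p : V × (Fin (j + 1) → V) => g (p.1, Fin.init p.2)) ∈ polyAlg V (j + 1))
    ?_ ?_ ?_ ?_ hg
  · rintro _ (⟨α, rfl⟩ | ⟨α, i, rfl⟩)
    · exact Algebra.subset_adjoin (Or.inl ⟨α, rfl⟩)
    · exact Algebra.subset_adjoin (Or.inr ⟨α, i.castSucc, rfl⟩)
  · exact fun r => (polyAlg V (j + 1)).algebraMap_mem r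
  · exact fun _ _ _ _ h1 h2 => (polyAlg V (j + 1)).add_mem h1 h2
  · exact fun _ _ _ _ h1 h2 => (polyAlg V (j + 1)).mul_mem h1 h2

theorem polyAlg_spec (j : ℕ) : ∀ g ∈ polyAlg V j, Continuous g ∧
    ∃ g' ∈ polyAlg V (j + 1), ∀ x (h : Fin (j + 1) → V),
      HasDirDeriv (fun y => g (y, Fin.init h)) x (h (Fin.last j)) (g' (x, h)) := by
  intro g hg
  refine Algebra.adjoin_induction (p := fun g _ => Continuous g ∧
    ∃ g' ∈ polyAlg V (j + 1), ∀ x (h : Fin (j + 1) → V),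
      HasDirDeriv (fun y => g (y, Fin.init h)) x (h (Fin.last j)) (g' (x, h))) ?_ ?_ ?_ ?_ hg
  · rintro _ (⟨α, rfl⟩ | ⟨α, i, rfl⟩)
    · exact ⟨by fun_prop, fun p => α (p.2 (Fin.last j)),
        Algebra.subset_adjoin (Or.inr ⟨α, _, rfl⟩), fun x h =>
          hasDirDeriv_clm α x (h (Fin.last j))⟩
    · exact ⟨by fun_prop, fun _ => 0, (polyAlg V (j + 1)).zero_mem, fun x h =>
        hasDirDeriv_const (α (h i.castSucc)) x (h (Fin.last j))⟩
  · exact fun r => ⟨continuous_const, fun _ => 0, (polyAlg V (j + 1)).zero_mem,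
      fun x h => hasDirDeriv_const r x (h (Fin.last j))⟩
  · rintro f g _ _ ⟨cf, f', hf', df⟩ ⟨cg, g', hg', dg⟩
    exact ⟨cf.add cg, f' + g', (polyAlg V (j + 1)).add_mem hf' hg',
      fun x h => (df x h).add (dg x h)⟩
  · rintro f g hf hg ⟨cf, f', hf', df⟩ ⟨cg, g', hg', dg⟩
    refine ⟨cf.mul cg, _, (polyAlg V (j + 1)).add_mem
      ((polyAlg V (j + 1)).mul_mem (polyAlg_init j f hf) hg')
      ((polyAlg V (j + 1)).mul_mem hf' (polyAlg_init j g hg)), fun x h => ?_⟩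
    exact (df x h).smul (dg x h) (cg.comp (by fun_prop))

theorem alg_poly (F : D.alg) : (fun p : V × (Fin 0 → V) => (F : V → ℝ) p.1) ∈ polyAlg V 0 := by
  refine D.alg_induction (p := fun F =>
    (fun p : V × (Fin 0 → V) => (F : V → ℝ) p.1) ∈ polyAlg V 0) ?_ ?_ ?_ ?_ F
  · exact fun r => (polyAlg V 0).algebraMap_mem r
  · exact fun α => Algebra.subset_adjoin (Or.inl ⟨α, rfl⟩)
  · exact fun _ _ h1 h2 => (polyAlg V 0).add_mem h1 h2
  · exact fun _ _ h1 h2 => (polyAlg V 0).mul_mem h1 h2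

theorem smoothOn_alg (F : D.alg) (U : Set V) : SmoothOn (F : V → ℝ) U :=
  smoothOn_of_class (fun j => (polyAlg V j : Set _)) (fun j g hg => (polyAlg_spec j g hg).1)
    (fun j g hg => (polyAlg_spec j g hg).2) (D.alg_poly F) (fun _ _ => rfl) U

/-- Polynomial vector fields, depending on `(x, h₁, …, hⱼ)`. -/
inductive PolyVec (V : Type*) [AddCommGroup V] [Module ℝ V] [TopologicalSpace V] (j : ℕ) :
    (V × (Fin j → V) → V) → Prop
  | const (c : V) : PolyVec V j fun _ => c
  | base (T : V →L[ℝ] V) : PolyVec V j fun p => T p.1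
  | dir (T : V →L[ℝ] V) (i : Fin j) : PolyVec V j fun p => T (p.2 i)
  | add {f g : V × (Fin j → V) → V} : PolyVec V j f → PolyVec V j g →
      PolyVec V j fun p => f p + g p
  | smul {p : V × (Fin j → V) → ℝ} {f : V × (Fin j → V) → V} : p ∈ polyAlg V j →
      PolyVec V j f → PolyVec V j fun q => p q • f q

theorem PolyVec.init {j : ℕ} {g : V × (Fin j → V) → V} (hg : PolyVec V j g) :
    PolyVec V (j + 1) fun p => g (p.1, Fin.init p.2) := by
  induction hg with
  | const c => exact .const c
  | base T => exact .base T
  | dir T i => exact .dir T i.castSucc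
  | add _ _ h1 h2 => exact .add h1 h2
  | smul hp _ h => exact .smul (polyAlg_init j _ hp) h

theorem PolyVec.spec [T2Space V] {j : ℕ} {g : V × (Fin j → V) → V} (hg : PolyVec V j g) :
    Continuous g ∧ ∃ g', PolyVec V (j + 1) g' ∧ ∀ x (h : Fin (j + 1) → V),
      HasDirDeriv (fun y => g (y, Fin.init h)) x (h (Fin.last j)) (g' (x, h)) := by
  induction hg with
  | const c => exact ⟨continuous_const, _, .const 0, fun x h =>
      hasDirDeriv_const c x (h (Fin.last j))⟩
  | base T => exact ⟨by fun_prop, _, .dir T (Fin.last j), fun x h =>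
      hasDirDeriv_clm T x (h (Fin.last j))⟩
  | dir T i => exact ⟨by fun_prop, _, .const 0, fun x h =>
      hasDirDeriv_const (T (h i.castSucc)) x (h (Fin.last j))⟩
  | add _ _ h1 h2 =>
    obtain ⟨cf, f', hf', df⟩ := h1
    obtain ⟨cg, g', hg', dg⟩ := h2
    exact ⟨cf.add cg, _, .add hf' hg', fun x h => (df x h).add (dg x h)⟩
  | smul hp hf h =>
    obtain ⟨cf, f', hf', df⟩ := h
    obtain ⟨cp, p', hp', dp⟩ := polyAlg_spec j _ hp
    exact ⟨cp.smul cf, _, .add (.smul (polyAlg_init j _ hp) hf') (.smul hp' hf.init),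
      fun x h => (dp x h).smul (df x h) (cf.comp (by fun_prop))⟩

theorem PolyVec.smoothOn [T2Space V] {X : V → V} (hX : PolyVec V 0 fun p => X p.1) (U : Set V) :
    SmoothOn X U :=
  smoothOn_of_class (fun j => {g | PolyVec V j g}) (fun _ _ hg => hg.spec.1)
    (fun _ _ hg => hg.spec.2) hX (fun _ _ => rfl) U

theorem exists_polyVec (H : D.alg) : ∃ X : V → V, PolyVec V 0 (fun p => X p.1) ∧
    ∀ (F : D.alg) (v : V), (D.diff F v : V →L[ℝ] ℝ) (X v) = D.poissonFun F H v := by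
  refine D.alg_induction (p := fun H => ∃ X : V → V, PolyVec V 0 (fun p => X p.1) ∧
    ∀ (F : D.alg) (v : V), (D.diff F v : V →L[ℝ] ℝ) (X v) = D.poissonFun F H v)
    ?_ ?_ ?_ ?_ H
  · exact fun r => ⟨fun _ => 0, .const 0, fun F v => by rw [poissonFun_const, map_zero]⟩
  · intro α
    obtain ⟨s, hs⟩ := D.exists_sharp α
    obtain ⟨T, hT⟩ := D.exists_adjoint α
    refine ⟨fun v => s + (-T) v, .add (.const s) (.base (-T)), fun F v => ?_⟩
    simp only [poissonFun, affineBracket, diff_toAlg]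
    rw [map_add, ← hs, D.bracket₀_skew]
    simp [hT]
  · rintro H K ⟨X, hX, eX⟩ ⟨Y, hY, eY⟩
    exact ⟨fun v => X v + Y v, .add hX hY, fun F v => by
      rw [map_add, eX, eY, poissonFun_add]⟩
  · rintro H K ⟨X, hX, eX⟩ ⟨Y, hY, eY⟩
    exact ⟨fun v => (K : V → ℝ) v • X v + (H : V → ℝ) v • Y v,
      .add (.smul (D.alg_poly K) hX) (.smul (D.alg_poly H) hY), fun F v => by
      rw [map_add, map_smul, map_smul, eX, eY, poissonFun_mul, smul_eq_mul, smul_eq_mul]; ring⟩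

theorem tangentMap_alg (F : D.alg) (v h : V) :
    tangentMap V ℝ (F : V → ℝ) v h = (D.diff F v : V →L[ℝ] ℝ) h :=
  (D.hasDirDeriv_diff F v h).eq

/-- The affine Poisson structure on `V` defined by the given data: the algebra `𝒜` is generated by
`V_*`, and `{F, G}(v) = ⟨[dF(v), dG(v)], v⟩`. -/
@[reducible] def toWeakPoisson [T2Space V] : WeakPoissonStructure V V where
  alg := D.alg
  smooth F hF := ⟨D.continuous_alg ⟨F, hF⟩, fun e he e' he' => by
    rw [chartedSpaceSelf_atlas] at he he'
    subst he he'
    exact D.smoothOn_alg ⟨F, hF⟩ _⟩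
  bracket := D.poisson
  skew := D.poisson_skew
  jacobi := D.poisson_jacobi
  leibniz := D.poisson_mul
  separating v w h := D.separating w fun α hα => by
    have := h (D.toAlg ⟨α, hα⟩)
    rwa [tangentMap_alg, diff_toAlg] at this
  exists_hamiltonian H := by
    obtain ⟨X, hX, eX⟩ := D.exists_polyVec H
    refine ⟨X, fun e he => ?_, fun F m => ?_⟩
    · rw [chartedSpaceSelf_atlas] at he
      subst he
      have : (fun y : V => dirDeriv (OpenPartialHomeomorph.refl V ∘
          (chartAt V ((OpenPartialHomeomorph.refl V).symm y)).symm)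
          (chartAt V ((OpenPartialHomeomorph.refl V).symm y)
            ((OpenPartialHomeomorph.refl V).symm y))
          (X ((OpenPartialHomeomorph.refl V).symm y))) = X :=
        funext fun y => (hasDirDeriv_clm (ContinuousLinearMap.id ℝ V) y (X y)).eq
      rw [this]
      exact hX.smoothOn _
    · rw [tangentMap_alg]; exact eX F m

end AffinePoissonData

/-- For `Φ : M → V` with `a ∘ Φ ∈ 𝒜_M` for all `a ∈ V̂_*`, the map
`φ : V_* → 𝒜_M`, `φ(α) = α ∘ Φ`. -/
def AffinePoissonData.pullback {E : Type*} [AddCommGroup E] [Module ℝ E] [TopologicalSpace E]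
    {M : Type*} [TopologicalSpace M] [ChartedSpace E M]
    (D : AffinePoissonData V) (P : WeakPoissonStructure E M) (Φ : M → V)
    (hA : ∀ a ∈ D.affineFunctions, a ∘ Φ ∈ P.alg) (α : D.dual) : P.alg :=
  ⟨(α : V →L[ℝ] ℝ) ∘ Φ, hA _ ⟨0, α, by funext v; simp⟩⟩

/-- A locally convex space is a manifold modelled on itself. -/
instance [T2Space V] : IsLCManifold V V where
  compatible e he e' he' := by
    rw [chartedSpaceSelf_atlas] at he he'
    subst he he'
    exact AffinePoissonData.PolyVec.smoothOn (X := fun x : V => x)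
      (.base (ContinuousLinearMap.id ℝ V)) _

end Affine

end LC

end

/-!
The equivalence rests on two observations.

The condition on brackets only has to be tested on generators. Once `Φ^*` is known to map `𝒜_V` to
`𝒜_M`, it is an algebra homomorphism, and for fixed `F` both `G ↦ Φ^*{F, G}` and
`G ↦ {Φ^*F, Φ^*G}` are derivations along `Φ^*`. Hence they agree if they agree on the generating
space `V_*`, and by skew-symmetry the same reduction applies to `F`
(`map_poisson_of_map_poisson_toAlg`).

On generators, the bracket condition is the relatedness of Hamiltonian vector fields, tested against
the functionals in `V_*`: since `T(Φ)` is compatible with continuous linear functionals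
(`clm_tangentMap`), a functional `β ∈ V_*` takes the value `{φ(β), φ(α)}(m)` on
`T_m(Φ) X_{φ(α)}(m)` and the value `{β, α}(Φ(m))` on `X_α(Φ(m))`. As `V_*` separates the points of
`V`, the two vectors are equal if and only if these values agree for all `β`.
-/

noncomputable section

namespace LC

theorem HasDirDeriv.clm_comp {E F G : Type*}
    [AddCommGroup E] [Module ℝ E] [TopologicalSpace E]
    [AddCommGroup F] [Module ℝ F] [TopologicalSpace F]
    [AddCommGroup G] [Module ℝ G] [TopologicalSpace G]
    (T : F →L[ℝ] G) {f : E → F} {x h : E} {y : F} (hf : HasDirDeriv f x h y) :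
    HasDirDeriv (T ∘ f) x h (T y) := by
  refine ((T.continuous.tendsto y).comp hf).congr fun t => ?_
  simp only [Function.comp_apply, map_smul, map_sub]

/-- The chain rule for a continuous linear functional: `T_m(β ∘ Φ) = β ∘ T_m(Φ)`. -/
theorem clm_tangentMap {E V M : Type*}
    [AddCommGroup E] [Module ℝ E] [TopologicalSpace E]
    [AddCommGroup V] [Module ℝ V] [TopologicalSpace V] [T2Space V]
    [TopologicalSpace M] [ChartedSpace E M]
    {Φ : M → V} (hΦ : SmoothMap E V Φ) (β : V →L[ℝ] ℝ) (m : M) (v : Tangent E m) :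
    tangentMap E ℝ (β ∘ Φ) m v = β (tangentMap E V Φ m v) := by
  have hs := hΦ.2 _ (chart_mem_atlas E m) _ (chart_mem_atlas V (Φ m))
  have hx : chartAt E m m ∈
      (chartAt E m).target ∩ (chartAt E m).symm ⁻¹' (Φ ⁻¹' (chartAt V (Φ m)).source) := by
    simp [chartAt_self_eq]
  exact ((hs.hasDirDeriv hx v).clm_comp β).eq

namespace WeakPoissonStructure

variable {E M : Type*} [AddCommGroup E] [Module ℝ E] [TopologicalSpace E]
  [TopologicalSpace M] [ChartedSpace E M]

theorem tangentMap_hamiltonian (P : WeakPoissonStructure E M) (F H : P.alg) (m : M) :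
    tangentMap E ℝ (F : M → ℝ) m (P.hamiltonian H m) = (P.bracket F H : M → ℝ) m :=
  (P.exists_hamiltonian H).choose_spec.2 F m

theorem bracket_algebraMap (P : WeakPoissonStructure E M) (F : P.alg) (r : ℝ) :
    P.bracket F (algebraMap ℝ P.alg r) = 0 := by
  have h := P.leibniz F 1 1
  simp only [mul_one, one_mul, left_eq_add] at h
  rw [Algebra.algebraMap_eq_smul_one, map_smul, h, smul_zero]

end WeakPoissonStructure

namespace AffinePoissonData

variable {V : Type*} [AddCommGroup V] [Module ℝ V] [TopologicalSpace V]
  [IsTopologicalAddGroup V] [ContinuousSMul ℝ V] (D : AffinePoissonData V)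
  {E M : Type*} [AddCommGroup E] [Module ℝ E] [TopologicalSpace E]
  [TopologicalSpace M] [ChartedSpace E M] (P : WeakPoissonStructure E M)

theorem comp_mem_of_affineFunctions {Φ : M → V} (hA : ∀ a ∈ D.affineFunctions, a ∘ Φ ∈ P.alg)
    (F : D.alg) : (F : V → ℝ) ∘ Φ ∈ P.alg := by
  refine D.alg_induction (p := fun F => (F : V → ℝ) ∘ Φ ∈ P.alg) ?_ ?_ ?_ ?_ F
  · exact fun r => P.alg.algebraMap_mem r
  · exact fun α => (D.pullback P Φ hA α).2
  · exact fun F G hF hG => P.alg.add_mem hF hG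
  · exact fun F G hF hG => P.alg.mul_mem hF hG

/-- The algebra homomorphism `Φ^* : 𝒜_V → 𝒜_M`, `F ↦ F ∘ Φ`. -/
def pullbackHom (Φ : M → V) (h : ∀ F : D.alg, (F : V → ℝ) ∘ Φ ∈ P.alg) : D.alg →ₐ[ℝ] P.alg where
  toFun F := ⟨(F : V → ℝ) ∘ Φ, h F⟩
  map_one' := rfl
  map_mul' _ _ := rfl
  map_zero' := rfl
  map_add' _ _ := rfl
  commutes' _ := rfl

variable {D P}

/-- An algebra homomorphism that is compatible with the brackets of `F` with the elements of `V_*`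
is compatible with all brackets of `F`, by the Leibniz rule. -/
theorem map_poisson_of_map_poisson_right (p : D.alg →ₐ[ℝ] P.alg) (F : D.alg)
    (h : ∀ β : D.dual, p (D.poisson F (D.toAlg β)) = P.bracket (p F) (p (D.toAlg β)))
    (G : D.alg) : p (D.poisson F G) = P.bracket (p F) (p G) := by
  refine D.alg_induction (p := fun G => p (D.poisson F G) = P.bracket (p F) (p G)) ?_ h ?_ ?_ G
  · intro r
    rw [poisson_const, map_zero, AlgHom.commutes, P.bracket_algebraMap]
  · intro G H hG hH
    simp only [map_add, hG, hH]
  · intro G H hG hH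
    simp only [poisson_mul, map_add, map_mul, hG, hH, P.leibniz]

theorem map_poisson_of_map_poisson_toAlg (p : D.alg →ₐ[ℝ] P.alg)
    (h : ∀ α β : D.dual, p (D.poisson (D.toAlg α) (D.toAlg β)) =
      P.bracket (p (D.toAlg α)) (p (D.toAlg β)))
    (F G : D.alg) : p (D.poisson F G) = P.bracket (p F) (p G) := by
  refine map_poisson_of_map_poisson_right p F (fun β => ?_) G
  rw [poisson_skew, map_neg, P.skew,
    map_poisson_of_map_poisson_right p (D.toAlg β) (h β) F]

end AffinePoissonData

end LC

end

theorem proposition3p1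
    {V : Type*} [AddCommGroup V] [Module ℝ V] [TopologicalSpace V] [IsTopologicalAddGroup V]
    [ContinuousSMul ℝ V] [LocallyConvexSpace ℝ V] [T2Space V]
    (D : LC.AffinePoissonData V)
    {E : Type*} [AddCommGroup E] [Module ℝ E] [TopologicalSpace E] [IsTopologicalAddGroup E]
    [ContinuousSMul ℝ E] [LocallyConvexSpace ℝ E] [T2Space E]
    {M : Type*} [TopologicalSpace M] [ChartedSpace E M] [LC.IsLCManifold E M]
    (P : LC.WeakPoissonStructure E M)
    (Φ : M → V) (hΦ : LC.SmoothMap E V Φ)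
    (hA : ∀ a ∈ D.affineFunctions, a ∘ Φ ∈ P.alg) :
    List.TFAE [
      LC.IsPoissonMap P D.toWeakPoisson Φ,
      ∀ α β : D.dual,
        (D.toWeakPoisson.bracket (D.toAlg α) (D.toAlg β) : V → ℝ) ∘ Φ =
          P.bracket (D.pullback P Φ hA α) (D.pullback P Φ hA β),
      ∀ (m : M) (α : D.dual),
        LC.tangentMap E V Φ m (P.hamiltonian (D.pullback P Φ hA α) m) =
          D.toWeakPoisson.hamiltonian (D.toAlg α) (Φ m)] := by
  tfae_have 1 → 2 := fun ⟨_, _, h⟩ α β => h (D.toAlg α) (D.toAlg β)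
  tfae_have 2 → 1 := by
    intro h
    have hmem := D.comp_mem_of_affineFunctions P hA
    refine ⟨hΦ, hmem, fun F G => ?_⟩
    exact congrArg Subtype.val (LC.AffinePoissonData.map_poisson_of_map_poisson_toAlg
      (D.pullbackHom P Φ hmem) (fun α β => Subtype.ext (h α β)) F G)
  -- The two sides of the relatedness condition, evaluated at `β ∈ V_*`.
  have hM : ∀ (m : M) (α β : D.dual), (β : V →L[ℝ] ℝ)
      (LC.tangentMap E V Φ m (P.hamiltonian (D.pullback P Φ hA α) m)) =
        (P.bracket (D.pullback P Φ hA β) (D.pullback P Φ hA α) : M → ℝ) m := fun m α β => by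
    rw [← LC.clm_tangentMap hΦ]
    exact P.tangentMap_hamiltonian (D.pullback P Φ hA β) _ m
  have hV : ∀ (v : V) (α β : D.dual), (β : V →L[ℝ] ℝ)
      (D.toWeakPoisson.hamiltonian (D.toAlg α) v) =
        (D.toWeakPoisson.bracket (D.toAlg β) (D.toAlg α) : V → ℝ) v := fun v α β => by
    rw [← D.toWeakPoisson.tangentMap_hamiltonian (D.toAlg β), D.tangentMap_alg, D.diff_toAlg]
  tfae_have 2 → 3 := by
    intro h m α
    refine sub_eq_zero.1 (D.separating _ fun β hβ => ?_)
    rw [map_sub, hM m α ⟨β, hβ⟩, hV (Φ m) α ⟨β, hβ⟩, sub_eq_zero]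
    exact (congrFun (h ⟨β, hβ⟩ α) m).symm
  tfae_have 3 → 2 := by
    intro h α β
    funext m
    rw [← hM m β α, h m β, hV]
    rfl
  tfae_finish
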